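/- For $p>-1$ let $J_p(x)=\sum_{n\ge 0}\frac{(-1)^n (x/2)^{p+2n}}{n!\,\Gamma(p+n+1)}$ be the Bessel function of the first kind and let $$\mathcal{J}_p(x)=2^p\Gamma(p+1)x^{-p}J_p(x)=\sum_{n\ge 0}\frac{(-1/4)^n}{(p+1)_n\,n!}x^{2n}$$ be its normalization, where $(p+1)_n=\Gamma(p+n+1)/\Gamma(p+1)$. Theorem. Let $-1<p\le -\tfrac12$ and let $j_{p,1}$ be the first positive zero of $J_p$ (which exists). Put $$\alpha=\frac{1}{8(p+1)(p+3)},\qquad \beta=\frac{\frac{1}{p+1}-\frac{p+2}{p+1}\mathcal{J}_{p+1}(j_{p,1})}{j_{p,1}^2\left(1-\mathcal{J}_{p+1}(j_{p,1})\right)}.$$ Then for all $x\in(0,j_{p,1})$ the denominators below are nonzero and $$\frac{\left(\frac{p+2}{p+1}-\alpha x^2\right)\mathcal{J}_{p+1}(x)}{\frac{1}{p+1}+\mathcal{J}_p(x)-\alpha x^2}<1<\frac{\left(\frac{p+2}{p+1}-\beta x^2\right)\mathcal{J}_{p+1}(x)}{\frac{1}{p+1}+\mathcal{J}_p(x)-\beta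 x^2}.$$ For each such $p$ the constants are best possible: $\alpha$ is the largest real $c$ such that the left inequality, with $c$ in place of $\alpha$, holds for all $x\in(0,j_{p,1})$, and $\beta$ is the smallest real $c$ such that the right inequality, with $c$ in place of $\beta$, holds for all $x\in(0,j_{p,1})$. -/

import Mathlib

open scoped Nat

/-- The Bessel function of the first kind of real order `p`,
`J_p(x) = ∑ (-1)^n (x/2)^(p+2n) / (n! Γ(p+n+1))`, for `x > 0`. -/
noncomputable def besselJ (p x : ℝ) : ℝ :=
  ∑' n : ℕ, (-1 : ℝ) ^ n * (x / 2) ^ (p + 2 * (n : ℝ)) / ((n ! : ℝ) * Real.Gamma (p + n + 1))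

/-- The normalized Bessel function `𝒥_p(x) = ∑ (-1/4)^n x^(2n) / ((p+1)_n n!)`, for real `x` and
`p > -1`, where `(p+1)_n` is the Pochhammer symbol. For `x > 0` it is
`2^p Γ(p+1) x^(-p) J_p(x)`; see `normBesselJ_eq`. -/
noncomputable def normBesselJ (p x : ℝ) : ℝ :=
  ∑' n : ℕ, (-1 / 4 : ℝ) ^ n / ((ascPochhammer ℝ n).eval (p + 1) * (n ! : ℝ)) * x ^ (2 * n)

theorem gamma_add_nat_eq_ascPochhammer {s : ℝ} (hs : 0 < s) (n : ℕ) :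
    Real.Gamma (s + n) = (ascPochhammer ℝ n).eval s * Real.Gamma s := by
  induction n with
  | zero => simp
  | succ k ih =>
    have h : s + (k : ℝ) ≠ 0 := by positivity
    rw [ascPochhammer_succ_eval, Nat.cast_succ, ← add_assoc, Real.Gamma_add_one h, ih]
    ring

theorem normBesselJ_eq {p x : ℝ} (hp : -1 < p) (hx : 0 < x) :
    normBesselJ p x = 2 ^ p * Real.Gamma (p + 1) * x ^ (-p) * besselJ p x := by
  unfold normBesselJ besselJ
  rw [← tsum_mul_left]
  refine tsum_congr fun n => ?_
  have hp1 : 0 < p + 1 := by linarith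
  have hG : Real.Gamma (p + 1) ≠ 0 := (Real.Gamma_pos_of_pos hp1).ne'
  have hA : (ascPochhammer ℝ n).eval (p + 1) ≠ 0 := (ascPochhammer_pos n _ hp1).ne'
  have hf : (n ! : ℝ) ≠ 0 := by positivity
  have e : p + (n : ℝ) + 1 = (p + 1) + n := by ring
  have h2 : (2 : ℝ) ^ p ≠ 0 := by positivity
  have hxp : x ^ p ≠ 0 := by positivity
  have e2 : (x / 2) ^ (p + 2 * (n : ℝ)) = x ^ p / 2 ^ p * (x ^ (2 * n) / 4 ^ n) := by
    rw [Real.rpow_add (by positivity), Real.div_rpow hx.le (by norm_num)]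
    congr 1
    rw [show (2 : ℝ) * (n : ℝ) = ((2 * n : ℕ) : ℝ) by push_cast; ring, Real.rpow_natCast, div_pow,
      pow_mul (2 : ℝ)]
    norm_num
  rw [e, gamma_add_nat_eq_ascPochhammer hp1, e2, Real.rpow_neg hx.le, div_pow]
  field_simp

/-- The first positive zero `j_{p,1}` of the Bessel function `J_p`. -/
noncomputable def besselFirstZero (p : ℝ) : ℝ :=
  sInf {x : ℝ | 0 < x ∧ besselJ p x = 0}

/-- The numerator `((p+2)/(p+1) - c x²) 𝒥_{p+1}(x)` of the Frame-type quotient. -/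
noncomputable def frameNum (p c x : ℝ) : ℝ :=
  ((p + 2) / (p + 1) - c * x ^ 2) * normBesselJ (p + 1) x

/-- The denominator `1/(p+1) + 𝒥_p(x) - c x²` of the Frame-type quotient. -/
noncomputable def frameDen (p c x : ℝ) : ℝ :=
  1 / (p + 1) + normBesselJ p x - c * x ^ 2

/-- The constant `α = 1/(8(p+1)(p+3))`. -/
noncomputable def frameAlpha (p : ℝ) : ℝ :=
  1 / (8 * (p + 1) * (p + 3))

/-- The constant
`β = (1/(p+1) - (p+2)/(p+1) 𝒥_{p+1}(j_{p,1})) / (j_{p,1}² (1 - 𝒥_{p+1}(j_{p,1})))`. -/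
noncomputable def frameBeta (p : ℝ) : ℝ :=
  (1 / (p + 1) - (p + 2) / (p + 1) * normBesselJ (p + 1) (besselFirstZero p)) /
    (besselFirstZero p ^ 2 * (1 - normBesselJ (p + 1) (besselFirstZero p)))

/-! With `a = p + 1` and `t = x² / 4`, the functions `1 - 𝒥_p` and `1 - 𝒥_{p+1}` are alternating
series in `t`. The latter is `t g(t)`, where `g = besselQuot (a + 1)` is positive and strictly
decreasing on `[0, 1]`. Comparing coefficients (`altSeries_frame_identity`) gives numerator −
denominator `= 4 t² g(t) (c - R(t))`, with `R = 1 / (8a(a+2)) + f / (4a g)` (`frameRatio`). For `a ≤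
1/2` the series `f` is positive on `(0, 1]` and strictly increasing on `[0, 1]`, so `R` is strictly
increasing.

The bound on `a` also puts the first zero at some `t₀ < 1`, so all of this holds up to `j_{p,1}`.
Then `α = R(0)` and `β = R(t₀)`, and the inequalities follow once the denominators are positive
(`frameDen_frameBeta_pos`). A constant beyond either endpoint value fails near that endpoint by
continuity. -/

/-! ### Alternating series whose coefficients at least halve -/

/-- The alternating power series `∑ (-1)^n e_n t^(n+1)`. -/
noncomputable def altSeries (e : ℕ → ℝ) (t : ℝ) : ℝ :=
  ∑' n : ℕ, (-1 : ℝ) ^ n * (e n * t ^ (n + 1))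

theorem le_geometric_of_two_mul_succ_le {e : ℕ → ℝ} (h2 : ∀ n, 2 * e (n + 1) ≤ e n) (n : ℕ) :
    e n ≤ e 0 * (1 / 2) ^ n := by
  induction n with
  | zero => simp
  | succ k ih => rw [pow_succ]; linarith [h2 k]

theorem norm_altSeries_term_le {e : ℕ → ℝ} (he : ∀ n, 0 < e n)
    (h2 : ∀ n, 2 * e (n + 1) ≤ e n) {t : ℝ} (ht : t ∈ Set.Icc (0 : ℝ) 1) (n : ℕ) :
    ‖(-1 : ℝ) ^ n * (e n * t ^ (n + 1))‖ ≤ e 0 * (1 / 2) ^ n := by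
  have h1 : t ^ (n + 1) ≤ 1 := pow_le_one₀ ht.1 ht.2
  have h0 : 0 ≤ t ^ (n + 1) := pow_nonneg ht.1 _
  rw [norm_mul, norm_pow, norm_neg, norm_one, one_pow, one_mul, Real.norm_eq_abs,
    abs_of_nonneg (mul_nonneg (he n).le h0)]
  exact (mul_le_of_le_one_right (he n).le h1).trans (le_geometric_of_two_mul_succ_le h2 n)

theorem summable_const_mul_half_pow (c : ℝ) : Summable fun n : ℕ => c * (1 / 2 : ℝ) ^ n :=
  (summable_geometric_of_lt_one (by norm_num) (by norm_num)).mul_left c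

theorem hasSum_altSeries {e : ℕ → ℝ} (he : ∀ n, 0 < e n)
    (h2 : ∀ n, 2 * e (n + 1) ≤ e n) {t : ℝ} (ht : t ∈ Set.Icc (0 : ℝ) 1) :
    HasSum (fun n : ℕ => (-1 : ℝ) ^ n * (e n * t ^ (n + 1))) (altSeries e t) :=
  (Summable.of_norm_bounded (summable_const_mul_half_pow (e 0))
    (norm_altSeries_term_le he h2 ht)).hasSum

theorem continuousOn_altSeries {e : ℕ → ℝ} (he : ∀ n, 0 < e n)
    (h2 : ∀ n, 2 * e (n + 1) ≤ e n) : ContinuousOn (altSeries e) (Set.Icc 0 1) :=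
  continuousOn_tsum (fun n => by fun_prop) (summable_const_mul_half_pow (e 0))
    fun n _ ht => norm_altSeries_term_le he h2 ht n

theorem altSeries_zero (e : ℕ → ℝ) : altSeries e 0 = 0 := by
  simp [altSeries]

/-- The second partial sum of an alternating series with decreasing terms is a lower bound. -/
theorem sub_le_of_hasSum_alternating {b : ℕ → ℝ} {l : ℝ} (hb : Antitone b)
    (hl : HasSum (fun n : ℕ => (-1 : ℝ) ^ n * b n) l) : b 0 - b 1 ≤ l := by
  have h := hb.alternating_series_le_tendsto hl.tendsto_sum_nat 1
  simp [Finset.sum_range_succ] at h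
  linarith

/-- The first term of an alternating series with decreasing terms is an upper bound. -/
theorem le_of_hasSum_alternating {b : ℕ → ℝ} {l : ℝ} (hb : Antitone b)
    (hl : HasSum (fun n : ℕ => (-1 : ℝ) ^ n * b n) l) : l ≤ b 0 := by
  have h := hb.tendsto_le_alternating_series hl.tendsto_sum_nat 0
  simpa using h

theorem antitone_altSeries_term {e : ℕ → ℝ} (he : ∀ n, 0 < e n)
    (h2 : ∀ n, 2 * e (n + 1) ≤ e n) {t : ℝ} (ht : t ∈ Set.Icc (0 : ℝ) 1) :
    Antitone fun n : ℕ => e n * t ^ (n + 1) := by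
  refine antitone_nat_of_succ_le fun n => ?_
  have h0 : 0 ≤ t ^ (n + 1) := pow_nonneg ht.1 _
  have h1 : t ^ (n + 1 + 1) ≤ t ^ (n + 1) := pow_le_pow_of_le_one ht.1 ht.2 (by omega)
  exact mul_le_mul (by linarith [h2 n, he (n + 1)]) h1 (pow_nonneg ht.1 _) (he n).le

theorem sub_le_altSeries {e : ℕ → ℝ} (he : ∀ n, 0 < e n)
    (h2 : ∀ n, 2 * e (n + 1) ≤ e n) {t : ℝ} (ht : t ∈ Set.Icc (0 : ℝ) 1) :
    e 0 * t - e 1 * t ^ 2 ≤ altSeries e t := by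
  simpa using sub_le_of_hasSum_alternating (antitone_altSeries_term he h2 ht)
    (hasSum_altSeries he h2 ht)

theorem altSeries_le {e : ℕ → ℝ} (he : ∀ n, 0 < e n)
    (h2 : ∀ n, 2 * e (n + 1) ≤ e n) {t : ℝ} (ht : t ∈ Set.Icc (0 : ℝ) 1) :
    altSeries e t ≤ e 0 * t := by
  simpa using le_of_hasSum_alternating (antitone_altSeries_term he h2 ht)
    (hasSum_altSeries he h2 ht)

theorem pow_succ_sub_pow_succ_le_two_mul {s t : ℝ} (ht : 0 ≤ t) (hts : t ≤ s) (hs : s ≤ 1)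
    (n : ℕ) : s ^ (n + 2) - t ^ (n + 2) ≤ 2 * (s ^ (n + 1) - t ^ (n + 1)) := by
  have hs0 : 0 ≤ s := ht.trans hts
  have h1 : t ^ n ≤ s ^ n := pow_le_pow_left₀ ht hts n
  have h2 : t ^ (n + 1) ≤ s ^ (n + 1) := pow_le_pow_left₀ ht hts (n + 1)
  have h3 : 0 ≤ t ^ n := pow_nonneg ht n
  have k1 : 0 ≤ (1 - s) * (s ^ (n + 1) - t ^ (n + 1)) :=
    mul_nonneg (by linarith) (by linarith)
  have k2 : 0 ≤ t * (s ^ n - t ^ n) := mul_nonneg ht (by linarith)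
  have k3 : t ^ n * t * (s - t) ≤ 1 * (s ^ n * (s - t)) := by
    rw [one_mul]
    refine mul_le_mul_of_nonneg_right ?_ (by linarith)
    nlinarith
  simp only [pow_succ] at *
  nlinarith

/-- For `t < s` the increments `s ^ (n + 1) - t ^ (n + 1)` at most double with `n`, while the
coefficients at least halve. The difference of the two values is thus again an alternating series
with decreasing terms, bounded below by its first two. -/
theorem strictMonoOn_altSeries {e : ℕ → ℝ} (he : ∀ n, 0 < e n)
    (h2 : ∀ n, 2 * e (n + 1) ≤ e n) : StrictMonoOn (altSeries e) (Set.Icc 0 1) := by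
  intro t ht s hs hts
  have hsum := (hasSum_altSeries he h2 hs).sub (hasSum_altSeries he h2 ht)
  have hsum' : HasSum (fun n : ℕ => (-1 : ℝ) ^ n * (e n * (s ^ (n + 1) - t ^ (n + 1))))
      (altSeries e s - altSeries e t) := by
    simp only [mul_sub]
    exact hsum
  have hanti : Antitone fun n : ℕ => e n * (s ^ (n + 1) - t ^ (n + 1)) := by
    refine antitone_nat_of_succ_le fun n => ?_
    have h1 := pow_succ_sub_pow_succ_le_two_mul ht.1 hts.le hs.2 n
    have h0 : 0 ≤ s ^ (n + 1) - t ^ (n + 1) := by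
      linarith [pow_le_pow_left₀ ht.1 hts.le (n + 1)]
    calc e (n + 1) * (s ^ (n + 2) - t ^ (n + 2))
        ≤ e (n + 1) * (2 * (s ^ (n + 1) - t ^ (n + 1))) :=
          mul_le_mul_of_nonneg_left h1 (he _).le
      _ = 2 * e (n + 1) * (s ^ (n + 1) - t ^ (n + 1)) := by ring
      _ ≤ _ := mul_le_mul_of_nonneg_right (h2 n) h0
  have h := sub_le_of_hasSum_alternating hanti hsum'
  simp only [zero_add, pow_one] at h
  -- The lower bound is `(s - t) * (e 0 - e 1 * (s + t))`; it is positive because `e 0 ≥ 2 * e 1`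
  -- and `s + t < 2`.
  have h3 : 0 < e 1 * ((s - t) * (2 - s - t)) :=
    mul_pos (he 1) (mul_pos (by linarith) (by linarith [hs.2]))
  have h4 : 0 ≤ (e 0 - 2 * e 1) * (s - t) :=
    mul_nonneg (by linarith [h2 0]) (by linarith)
  norm_num at h
  nlinarith

theorem altSeries_pos {e : ℕ → ℝ} (he : ∀ n, 0 < e n)
    (h2 : ∀ n, 2 * e (n + 1) ≤ e n) {t : ℝ} (ht : t ∈ Set.Ioc (0 : ℝ) 1) :
    0 < altSeries e t := by
  have := strictMonoOn_altSeries he h2 (Set.left_mem_Icc.2 zero_le_one) ⟨ht.1.le, ht.2⟩ ht.1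
  rwa [altSeries_zero] at this

theorem altSeries_eq_mul_sub {e : ℕ → ℝ} (he : ∀ n, 0 < e n)
    (h2 : ∀ n, 2 * e (n + 1) ≤ e n) {t : ℝ} (ht : t ∈ Set.Icc (0 : ℝ) 1) :
    altSeries e t = t * (e 0 - altSeries (fun n => e (n + 1)) t) := by
  have h := (hasSum_altSeries he h2 ht)
  have h' := (hasSum_altSeries (fun n => he (n + 1)) (fun n => h2 (n + 1)) ht).mul_left (-t)
  rw [← hasSum_nat_add_iff' 1] at h
  have hterm : (fun n : ℕ => (-1 : ℝ) ^ (n + 1) * (e (n + 1) * t ^ (n + 1 + 1))) =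
      fun n : ℕ => -t * ((-1 : ℝ) ^ n * (e (n + 1) * t ^ (n + 1))) := by
    funext n
    ring
  rw [hterm] at h
  have := h.unique h'
  simp at this
  linarith

/-! ### Coefficients of the Bessel series -/

/-- The coefficients of `1 - 𝒥_p` as an alternating series in `x² / 4`, with `a = p + 1`. -/
noncomputable def besselCoeff (a : ℝ) (n : ℕ) : ℝ :=
  1 / ((ascPochhammer ℝ (n + 1)).eval a * ((n + 1)! : ℝ))

theorem besselCoeff_pos {a : ℝ} (ha : 0 < a) (n : ℕ) : 0 < besselCoeff a n := by
  have := ascPochhammer_pos (n + 1) a ha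
  unfold besselCoeff
  positivity

theorem besselCoeff_zero (a : ℝ) : besselCoeff a 0 = 1 / a := by
  simp [besselCoeff]

theorem besselCoeff_succ (a : ℝ) (n : ℕ) :
    besselCoeff a (n + 1) = besselCoeff a n / ((a + n + 1) * (n + 2)) := by
  unfold besselCoeff
  rw [ascPochhammer_succ_eval (n + 1), Nat.factorial_succ (n + 1), div_div]
  push_cast
  congr 1
  ring

theorem two_mul_besselCoeff_succ_le {a : ℝ} (ha : 0 < a) (n : ℕ) :
    2 * besselCoeff a (n + 1) ≤ besselCoeff a n := by
  have h := besselCoeff_pos ha n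
  have hn : (0 : ℝ) ≤ n := n.cast_nonneg
  rw [besselCoeff_succ, ← mul_div_assoc, div_le_iff₀ (by positivity)]
  nlinarith [mul_nonneg hn hn, mul_nonneg ha.le hn]

/-- Makes the `n`-th coefficient of `(a + 1)(1 - 𝒥_{p+1}) - a (1 - 𝒥_p)` equal to `-n * besselCoeff
(a + 1) n`, up to the alternating sign. -/
theorem mul_besselCoeff (a : ℝ) (ha : 0 < a) (n : ℕ) :
    a * besselCoeff a n = (a + n + 1) * besselCoeff (a + 1) n := by
  have h1 := ascPochhammer_pos n (a + 1) (by linarith)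
  have h2 := ascPochhammer_pos (n + 1) a ha
  have hn : (0 : ℝ) < a + n + 1 := by positivity
  have h3 : (ascPochhammer ℝ (n + 1)).eval a = a * (ascPochhammer ℝ n).eval (a + 1) := by
    simp [ascPochhammer_succ_left]
  unfold besselCoeff
  rw [h3, ascPochhammer_succ_eval n (a + 1)]
  field_simp
  ring

theorem normBesselJ_eq_one_sub {p x : ℝ} (hp : -1 < p) (hx : x ^ 2 / 4 ∈ Set.Icc (0 : ℝ) 1) :
    normBesselJ p x = 1 - altSeries (besselCoeff (p + 1)) (x ^ 2 / 4) := by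
  have ha : 0 < p + 1 := by linarith
  have h := (hasSum_altSeries (besselCoeff_pos ha) (two_mul_besselCoeff_succ_le ha) hx).neg
  have h' : HasSum (fun n : ℕ => (-1 / 4 : ℝ) ^ n /
      ((ascPochhammer ℝ n).eval (p + 1) * (n ! : ℝ)) * x ^ (2 * n))
      (1 - altSeries (besselCoeff (p + 1)) (x ^ 2 / 4)) := by
    rw [← hasSum_nat_add_iff' 1]
    convert h using 1
    · funext n
      unfold besselCoeff
      rw [pow_mul, div_pow, div_pow, pow_succ (-1 : ℝ)]
      ring
    · simp
  exact h'.tsum_eq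

/-! ### The coefficient identity behind the quotient -/

/-- The coefficients of the alternating series in `t = x² / 4` for
`(1 + a 𝒥_p - (a + 1) 𝒥_{p+1} - t / (2 (a + 2)) (1 - 𝒥_{p+1})) / t²`, with `a = p + 1`. -/
noncomputable def frameCoeff (a : ℝ) (n : ℕ) : ℝ :=
  (n + 1) * (n + 1 - a) / (2 * (a + 2)) * besselCoeff (a + 1) (n + 2)

theorem frameCoeff_pos {a : ℝ} (ha : 0 < a) (ha' : a ≤ 1 / 2) (n : ℕ) : 0 < frameCoeff a n := by
  have h := besselCoeff_pos (a := a + 1) (by linarith) (n + 2)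
  have hn : (0 : ℝ) ≤ n := n.cast_nonneg
  have h1 : 0 < (n : ℝ) + 1 - a := by linarith
  unfold frameCoeff
  positivity

theorem two_mul_frameCoeff_succ_le {a : ℝ} (ha : 0 < a) (ha' : a ≤ 1 / 2) (n : ℕ) :
    2 * frameCoeff a (n + 1) ≤ frameCoeff a n := by
  have h := besselCoeff_pos (a := a + 1) (by linarith) (n + 2)
  have hn : (0 : ℝ) ≤ n := n.cast_nonneg
  have key : 2 * (((n : ℝ) + 2) * (n + 2 - a)) ≤
      (n + 1) * (n + 1 - a) * ((a + 1 + (n + 2) + 1) * (n + 2 + 2)) := by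
    have h1 : (n : ℝ) + 2 ≤ 2 * (n + 1) := by linarith
    -- At `n = 0` this is exactly `a ≤ 1 / 2`. The 12 below is `2 * 2 * 3`, from the three factors
    -- lost.
    have h2 : (n : ℝ) + 2 - a ≤ 3 * (n + 1 - a) := by linarith
    have h3 : 12 ≤ (a + 1 + ((n : ℝ) + 2) + 1) * (n + 2 + 2) := by
      nlinarith [mul_nonneg ha.le hn]
    have h4 : ((n : ℝ) + 2) * (n + 2 - a) ≤ 2 * (n + 1) * (3 * (n + 1 - a)) :=
      mul_le_mul h1 h2 (by linarith) (by linarith)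
    have h5 : 0 ≤ ((n : ℝ) + 1) * (n + 1 - a) := mul_nonneg (by linarith) (by linarith)
    nlinarith [mul_le_mul_of_nonneg_left h3 h5]
  unfold frameCoeff
  rw [show n + 1 + 2 = n + 2 + 1 by ring, besselCoeff_succ (a + 1) (n + 2)]
  push_cast
  have hd : (0 : ℝ) < (a + 1 + (n + 2) + 1) * (n + 2 + 2) := by positivity
  have e1 : 2 * (((n : ℝ) + 1 + 1) * (n + 1 + 1 - a) / (2 * (a + 2)) *
      (besselCoeff (a + 1) (n + 2) / ((a + 1 + (n + 2) + 1) * (n + 2 + 2)))) =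
      (2 * (((n : ℝ) + 2) * (n + 2 - a)) / ((a + 1 + (n + 2) + 1) * (n + 2 + 2))) *
      (besselCoeff (a + 1) (n + 2) / (2 * (a + 2))) := by
    field_simp
    ring
  have e2 : ((n : ℝ) + 1) * (n + 1 - a) / (2 * (a + 2)) * besselCoeff (a + 1) (n + 2) =
      (n + 1) * (n + 1 - a) * (besselCoeff (a + 1) (n + 2) / (2 * (a + 2))) := by ring
  rw [e1, e2]
  refine mul_le_mul_of_nonneg_right ?_ (by positivity)
  rwa [div_le_iff₀ hd]

/-- With `1 - 𝒥_p` and `1 - 𝒥_{p+1}` written as alternating series in `t = x² / 4`, this is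
`1 + a 𝒥_p - (a + 1) 𝒥_{p+1} = t / (2 (a + 2)) (1 - 𝒥_{p+1}) + t² f(t)`. -/
theorem altSeries_frame_identity {a : ℝ} (ha : 0 < a) (ha' : a ≤ 1 / 2) {t : ℝ}
    (ht : t ∈ Set.Icc (0 : ℝ) 1) :
    (a + 1) * altSeries (besselCoeff (a + 1)) t - a * altSeries (besselCoeff a) t =
      t / (2 * (a + 2)) * altSeries (besselCoeff (a + 1)) t +
        t ^ 2 * altSeries (frameCoeff a) t := by
  have ha1 : 0 < a + 1 := by linarith
  have hk := hasSum_altSeries (besselCoeff_pos ha1) (two_mul_besselCoeff_succ_le ha1) ht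
  have hh := hasSum_altSeries (besselCoeff_pos ha) (two_mul_besselCoeff_succ_le ha) ht
  have hf := (hasSum_altSeries (frameCoeff_pos ha ha') (two_mul_frameCoeff_succ_le ha ha')
    ht).mul_left (t ^ 2)
  have hP := (hk.mul_left (a + 1)).sub (hh.mul_left a)
  have hK := hk.mul_left (t / (2 * (a + 2)))
  -- The order `t` terms on the left cancel, and `1 / (2 (a + 2))` is the factor that matches order
  -- `t²`. From `t³` on, the coefficients agree because `(a+n+3)(n+3) - 2(n+2)(a+2) = (n+1)(n+1-a)`.
  rw [← hasSum_nat_add_iff' 2] at hP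
  rw [← hasSum_nat_add_iff' 1] at hK
  have h := hP.unique <| by
    convert hK.add hf using 1
    funext n
    have h1 := mul_besselCoeff a ha (n + 2)
    have h3 := besselCoeff_succ (a + 1) (n + 1)
    have hd : (0 : ℝ) < (a + 1 + ((n + 1 : ℕ) : ℝ) + 1) * (((n + 1 : ℕ) : ℝ) + 2) := by
      positivity
    rw [eq_div_iff hd.ne'] at h3
    have e0 : a * ((-1 : ℝ) ^ (n + 2) * (besselCoeff a (n + 2) * t ^ (n + 2 + 1))) =
      (-1 : ℝ) ^ (n + 2) * ((a * besselCoeff a (n + 2)) * t ^ (n + 2 + 1)) := by ring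
    simp only [e0, h1]
    unfold frameCoeff
    rw [← h3]
    push_cast
    field_simp
    ring
  have hm1 := mul_besselCoeff a ha 1
  have hc1 := besselCoeff_succ (a + 1) 0
  simp only [Nat.cast_zero, add_zero, zero_add, Nat.cast_one, besselCoeff_zero] at hm1 hc1
  have hA : a * (1 / a) = 1 := by field_simp
  have hB : (a + 1) * (1 / (a + 1)) = 1 := by field_simp
  have hC : t / (2 * (a + 2)) * (1 / (a + 1)) = besselCoeff (a + 1) 1 * t := by
    rw [hc1]; field_simp; ring
  simp only [Finset.sum_range_succ, Finset.sum_range_zero, zero_add, pow_zero, pow_one, one_mul,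
    besselCoeff_zero] at h
  linear_combination h + t * hB - t * hA + t ^ 2 * hm1 - t * hC

/-! ### The quotient, the zero below `t = 1` and the monotone ratio -/

/-- `(1 - 𝒥_p) / t` as a function of `t = x² / 4`, with `a = p + 1`. -/
noncomputable def besselQuot (a t : ℝ) : ℝ :=
  1 / a - altSeries (fun n => besselCoeff a (n + 1)) t

theorem altSeries_besselCoeff {a : ℝ} (ha : 0 < a) {t : ℝ} (ht : t ∈ Set.Icc (0 : ℝ) 1) :
    altSeries (besselCoeff a) t = t * besselQuot a t := by
  rw [altSeries_eq_mul_sub (besselCoeff_pos ha) (two_mul_besselCoeff_succ_le ha) ht,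
    besselCoeff_zero, besselQuot]

theorem besselQuot_strictAntiOn {a : ℝ} (ha : 0 < a) :
    StrictAntiOn (besselQuot a) (Set.Icc 0 1) := fun _ hx _ hy hxy =>
  sub_lt_sub_left (strictMonoOn_altSeries (fun n => besselCoeff_pos ha (n + 1))
    (fun n => two_mul_besselCoeff_succ_le ha (n + 1)) hx hy hxy) _

theorem continuousOn_besselQuot {a : ℝ} (ha : 0 < a) :
    ContinuousOn (besselQuot a) (Set.Icc 0 1) :=
  continuousOn_const.sub (continuousOn_altSeries (fun n => besselCoeff_pos ha (n + 1))
    (fun n => two_mul_besselCoeff_succ_le ha (n + 1)))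

theorem besselQuot_pos {a : ℝ} (ha : 0 < a) {t : ℝ} (ht : t ∈ Set.Icc (0 : ℝ) 1) :
    0 < besselQuot a t := by
  have h1 : (1 : ℝ) ∈ Set.Icc (0 : ℝ) 1 := Set.right_mem_Icc.2 zero_le_one
  have h := altSeries_pos (besselCoeff_pos ha) (two_mul_besselCoeff_succ_le ha)
    (Set.right_mem_Ioc.2 zero_lt_one)
  rw [altSeries_besselCoeff ha h1, one_mul] at h
  exact h.trans_le ((besselQuot_strictAntiOn ha).antitoneOn ht h1 ht.2)

theorem altSeries_besselCoeff_lt_one {a : ℝ} (ha : 1 < a) {t : ℝ}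
    (ht : t ∈ Set.Icc (0 : ℝ) 1) : altSeries (besselCoeff a) t < 1 := by
  have ha0 : 0 < a := by linarith
  have h := altSeries_le (besselCoeff_pos ha0) (two_mul_besselCoeff_succ_le ha0) ht
  have h1 : 1 / a < 1 := (div_lt_one ha0).2 ha
  have h2 : 0 < 1 / a := by positivity
  rw [besselCoeff_zero] at h
  nlinarith [ht.2]

theorem one_lt_altSeries_besselCoeff_one {a : ℝ} (ha : 0 < a) (ha' : a ≤ 1 / 2) :
    1 < altSeries (besselCoeff a) 1 := by
  refine lt_of_lt_of_le ?_ (sub_le_altSeries (besselCoeff_pos ha)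
    (two_mul_besselCoeff_succ_le ha) (Set.right_mem_Icc.2 zero_le_one))
  rw [besselCoeff_succ, besselCoeff_zero]
  push_cast
  -- Two terms of the series suffice, since `a ≤ 1 / 2` gives `2 * a ^ 2 < 1`.
  have e : 1 / a * 1 - 1 / a / ((a + 0 + 1) * (0 + 2)) * 1 ^ 2 - 1 =
      (1 - 2 * a ^ 2) / (2 * a * (a + 1)) := by
    field_simp
    ring
  have : 0 < (1 - 2 * a ^ 2) / (2 * a * (a + 1)) := div_pos (by nlinarith) (by positivity)
  linarith

theorem exists_altSeries_besselCoeff_eq_one {a : ℝ} (ha : 0 < a) (ha' : a ≤ 1 / 2) :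
    ∃ t ∈ Set.Ioo (0 : ℝ) 1, altSeries (besselCoeff a) t = 1 := by
  have h := intermediate_value_Ioo zero_le_one
    (continuousOn_altSeries (besselCoeff_pos ha) (two_mul_besselCoeff_succ_le ha))
  rw [altSeries_zero] at h
  exact h ⟨zero_lt_one, one_lt_altSeries_besselCoeff_one ha ha'⟩

/-- The function of `t = x² / 4` whose difference from `c` has the sign of
`frameNum p c x - frameDen p c x`, with `a = p + 1`. -/
noncomputable def frameRatio (a t : ℝ) : ℝ :=
  1 / (8 * a * (a + 2)) + altSeries (frameCoeff a) t / (4 * a * besselQuot (a + 1) t)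

theorem frameRatio_strictMonoOn {a : ℝ} (ha : 0 < a) (ha' : a ≤ 1 / 2) :
    StrictMonoOn (frameRatio a) (Set.Icc 0 1) := by
  intro t ht s hs hts
  have ha1 : 0 < a + 1 := by linarith
  have hf := strictMonoOn_altSeries (frameCoeff_pos ha ha') (two_mul_frameCoeff_succ_le ha ha')
    ht hs hts
  have hfs := altSeries_pos (frameCoeff_pos ha ha') (two_mul_frameCoeff_succ_le ha ha')
    ⟨ht.1.trans_lt hts, hs.2⟩
  have hg := besselQuot_strictAntiOn ha1 ht hs hts
  have hgs := besselQuot_pos ha1 hs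
  refine add_lt_add_right ?_ _
  refine div_lt_div₀ hf ?_ hfs.le (by positivity)
  exact mul_le_mul_of_nonneg_left hg.le (by positivity)

theorem continuousOn_frameRatio {a : ℝ} (ha : 0 < a) (ha' : a ≤ 1 / 2) :
    ContinuousOn (frameRatio a) (Set.Icc 0 1) := by
  have ha1 : 0 < a + 1 := by linarith
  refine continuousOn_const.add (ContinuousOn.div
    (continuousOn_altSeries (frameCoeff_pos ha ha') (two_mul_frameCoeff_succ_le ha ha'))
    (continuousOn_const.mul (continuousOn_besselQuot ha1)) fun t ht => ?_)
  have := besselQuot_pos ha1 ht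
  positivity

theorem frameRatio_zero (a : ℝ) : frameRatio a 0 = 1 / (8 * a * (a + 2)) := by
  simp [frameRatio, altSeries_zero]

theorem frameNum_sub_frameDen {p : ℝ} (hp : -1 < p) (hp' : p ≤ -1 / 2) (c : ℝ) {x : ℝ}
    (hx : x ^ 2 / 4 ∈ Set.Icc (0 : ℝ) 1) :
    frameNum p c x - frameDen p c x =
      4 * (x ^ 2 / 4) ^ 2 * besselQuot (p + 1 + 1) (x ^ 2 / 4) *
        (c - frameRatio (p + 1) (x ^ 2 / 4)) := by
  have ha : 0 < p + 1 := by linarith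
  have ha1 : 0 < p + 1 + 1 := by linarith
  have hg := besselQuot_pos ha1 hx
  have hid := altSeries_frame_identity ha (by linarith) hx
  unfold frameNum frameDen frameRatio
  rw [normBesselJ_eq_one_sub hp hx, normBesselJ_eq_one_sub (by linarith) hx]
  rw [altSeries_besselCoeff ha1 hx] at hid ⊢
  generalize altSeries (besselCoeff (p + 1)) (x ^ 2 / 4) = h at *
  generalize altSeries (frameCoeff (p + 1)) (x ^ 2 / 4) = f at *
  generalize besselQuot (p + 1 + 1) (x ^ 2 / 4) = g at *
  obtain ⟨a, rfl⟩ : ∃ a, p = a - 1 := ⟨p + 1, by ring⟩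
  rw [show x ^ 2 = 4 * (x ^ 2 / 4) by ring]
  rw [show a - 1 + 1 = a by ring] at *
  rw [show a - 1 + 2 = a + 1 by ring] at *
  rw [show 4 * (x ^ 2 / 4) / 4 = x ^ 2 / 4 by ring]
  generalize x ^ 2 / 4 = t at *
  have ha2 : a + 2 ≠ 0 := by positivity
  field_simp at hid ⊢
  linear_combination (-4) * hid

theorem frameDen_eq {p : ℝ} (hp : -1 < p) (c : ℝ) {x : ℝ}
    (hx : x ^ 2 / 4 ∈ Set.Icc (0 : ℝ) 1) :
    frameDen p c x =
      1 / (p + 1) + (1 - altSeries (besselCoeff (p + 1)) (x ^ 2 / 4)) - 4 * c * (x ^ 2 / 4) := by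
  unfold frameDen
  rw [normBesselJ_eq_one_sub hp hx]
  ring

theorem sq_two_mul_sqrt_div_four {t : ℝ} (ht : 0 ≤ t) : (2 * √t) ^ 2 / 4 = t := by
  rw [mul_pow, Real.sq_sqrt ht]
  ring

/-! ### The first zero, the constant `β` and the sign of the denominator -/

theorem isLeast_besselJ_zero {p t₀ : ℝ} (hp : -1 < p) (ht₀ : t₀ ∈ Set.Ioo (0 : ℝ) 1)
    (h₀ : altSeries (besselCoeff (p + 1)) t₀ = 1) :
    IsLeast {x : ℝ | 0 < x ∧ besselJ p x = 0} (2 * √t₀) := by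
  have ha : 0 < p + 1 := by linarith
  have hiff : ∀ x : ℝ, 0 < x → (besselJ p x = 0 ↔ normBesselJ p x = 0) := by
    intro x hx
    have hG := Real.Gamma_pos_of_pos ha
    have h : 2 ^ p * Real.Gamma (p + 1) * x ^ (-p) ≠ 0 := by positivity
    rw [normBesselJ_eq hp hx, mul_eq_zero, or_iff_right h]
  have hs := Real.sqrt_pos.2 ht₀.1
  refine ⟨⟨by positivity, ?_⟩, fun x ⟨hx, hx0⟩ => ?_⟩
  · rw [hiff _ (by positivity), normBesselJ_eq_one_sub hp, sq_two_mul_sqrt_div_four ht₀.1.le, h₀,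
      sub_self]
    rw [sq_two_mul_sqrt_div_four ht₀.1.le]
    exact ⟨ht₀.1.le, ht₀.2.le⟩
  · by_contra! hlt
    have hxt : x ^ 2 / 4 < t₀ := by
      have h1 : x ^ 2 < (2 * √t₀) ^ 2 := pow_lt_pow_left₀ hlt hx.le two_ne_zero
      have h2 := sq_two_mul_sqrt_div_four ht₀.1.le
      linarith
    have hxI : x ^ 2 / 4 ∈ Set.Icc (0 : ℝ) 1 := ⟨by positivity, (hxt.trans ht₀.2).le⟩
    have h1 := strictMonoOn_altSeries (besselCoeff_pos ha) (two_mul_besselCoeff_succ_le ha)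
      hxI ⟨ht₀.1.le, ht₀.2.le⟩ hxt
    rw [hiff _ hx, normBesselJ_eq_one_sub hp hxI] at hx0
    linarith

/-- At the zero, `c = frameRatio (p + 1) t₀` makes numerator and denominator equal. With `𝒥_p = 0`
this is a linear equation for `c`, solved by `frameBeta p`. -/
theorem frameBeta_eq_frameRatio {p t₀ : ℝ} (hp : -1 < p) (hp' : p ≤ -1 / 2)
    (ht₀ : t₀ ∈ Set.Ioo (0 : ℝ) 1) (h₀ : altSeries (besselCoeff (p + 1)) t₀ = 1) :
    frameBeta p = frameRatio (p + 1) t₀ := by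
  have ha1 : 0 < p + 1 + 1 := by linarith
  have hj : besselFirstZero p = 2 * √t₀ := (isLeast_besselJ_zero hp ht₀ h₀).csInf_eq
  have hI : t₀ ∈ Set.Icc (0 : ℝ) 1 := ⟨ht₀.1.le, ht₀.2.le⟩
  have hsq := sq_two_mul_sqrt_div_four ht₀.1.le
  have hx : (2 * √t₀) ^ 2 / 4 ∈ Set.Icc (0 : ℝ) 1 := by rwa [hsq]
  have key := frameNum_sub_frameDen hp hp' (frameRatio (p + 1) t₀) hx
  have hg := besselQuot_pos ha1 hI
  have ht := ht₀.1
  rw [hsq, sub_self, mul_zero] at key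
  unfold frameNum frameDen at key
  unfold frameBeta
  rw [hj]
  have hpos : 0 < (2 * √t₀) ^ 2 * (1 - normBesselJ (p + 1) (2 * √t₀)) := by
    rw [normBesselJ_eq_one_sub (by linarith) hx, hsq, altSeries_besselCoeff ha1 hI, sub_sub_cancel]
    have := Real.sqrt_pos.2 ht
    positivity
  have hv : normBesselJ p (2 * √t₀) = 0 := by
    rw [normBesselJ_eq_one_sub hp hx, hsq, h₀, sub_self]
  rw [hv] at key
  rw [div_eq_iff hpos.ne']
  linear_combination -key

/-- As `β > 0`, the denominator decreases in `t`, so its value at `t₀` decides. -/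
theorem frameDen_frameBeta_pos {p t₀ x : ℝ} (hp : -1 < p) (hp' : p ≤ -1 / 2)
    (ht₀ : t₀ ∈ Set.Ioo (0 : ℝ) 1) (h₀ : altSeries (besselCoeff (p + 1)) t₀ = 1)
    (hx : x ^ 2 / 4 ∈ Set.Ioc 0 t₀) : 0 < frameDen p (frameBeta p) x := by
  have ha : 0 < p + 1 := by linarith
  have ha1 : 0 < p + 1 + 1 := by linarith
  have hI : t₀ ∈ Set.Icc (0 : ℝ) 1 := ⟨ht₀.1.le, ht₀.2.le⟩
  have hxI : x ^ 2 / 4 ∈ Set.Icc (0 : ℝ) 1 := ⟨hx.1.le, hx.2.trans ht₀.2.le⟩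
  have hsq := sq_two_mul_sqrt_div_four ht₀.1.le
  have hj : (2 * √t₀) ^ 2 / 4 ∈ Set.Icc (0 : ℝ) 1 := by rwa [hsq]
  have hβ := frameBeta_eq_frameRatio hp hp' ht₀ h₀
  have hβ0 : 0 < frameBeta p := by
    have h := frameRatio_strictMonoOn ha (by linarith) (Set.left_mem_Icc.2 zero_le_one) hI ht₀.1
    rw [frameRatio_zero, ← hβ] at h
    exact lt_trans (by positivity) h
  have key := frameNum_sub_frameDen hp hp' (frameBeta p) hj
  rw [hsq, hβ, sub_self, mul_zero, ← hβ, frameDen_eq hp _ hj, hsq, h₀, frameNum,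
    normBesselJ_eq_one_sub (by linarith) hj, hsq,
    show (2 * √t₀) ^ 2 = 4 * t₀ by linarith] at key
  have hu := altSeries_besselCoeff_lt_one (show 1 < p + 1 + 1 by linarith) hI
  have hk := mul_pos ht₀.1 (besselQuot_pos ha1 hI)
  rw [← altSeries_besselCoeff ha1 hI] at hk
  -- Write `D` for this value and `u = 1 - 𝒥_{p+1}` at the zero. Numerator = denominator reads `(D +
  -- 1) * (1 - u) = D`, so `D * u = 1 - u > 0`.
  have hend : 0 < 1 / (p + 1) - 4 * frameBeta p * t₀ := by
    refine pos_of_mul_pos_left (b := altSeries (besselCoeff (p + 1 + 1)) t₀) ?_ hk.le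
    have h1 : (p + 2) / (p + 1) = 1 / (p + 1) + 1 := by field_simp; ring
    rw [h1] at key
    nlinarith
  have hv := (strictMonoOn_altSeries (besselCoeff_pos ha)
    (two_mul_besselCoeff_succ_le ha)).monotoneOn hxI hI hx.2
  rw [frameDen_eq hp _ hxI]
  have := mul_le_mul_of_nonneg_left hx.2 hβ0.le
  linarith

/-- Moves positivity from an endpoint, where optimality is decided, into the open interval, where
the inequality is assumed. -/
theorem exists_pos_pos_of_continuousOn {A B : ℝ → ℝ} {a b r u v : ℝ}
    (hA : ContinuousOn A (Set.Icc a b)) (hB : ContinuousOn B (Set.Icc a b))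
    (hr : r ∈ Set.Icc u v) (huv : u < v) (hsub : Set.Icc u v ⊆ Set.Icc a b)
    (hAr : 0 < A r) (hBr : 0 < B r) : ∃ t ∈ Set.Ioo u v, 0 < A t ∧ 0 < B t := by
  have hrc : r ∈ closure (Set.Ioo u v) := by rwa [closure_Ioo huv.ne]
  have hne : (nhdsWithin r (Set.Ioo u v)).NeBot := mem_closure_iff_nhdsWithin_neBot.1 hrc
  have hle : nhdsWithin r (Set.Ioo u v) ≤ nhdsWithin r (Set.Icc a b) :=
    nhdsWithin_mono r (Set.Ioo_subset_Icc_self.trans hsub)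
  have h1 := ((hA r (hsub hr)).mono_left hle).eventually (lt_mem_nhds hAr)
  have h2 := ((hB r (hsub hr)).mono_left hle).eventually (lt_mem_nhds hBr)
  obtain ⟨t, ⟨h1, h2⟩, ht⟩ := ((h1.and h2).and self_mem_nhdsWithin).exists
  exact ⟨t, ht, h1, h2⟩

/-! ### The double inequality and its optimality -/

theorem theorem1 (p : ℝ) (hp : -1 < p) (hp' : p ≤ -1 / 2) :
    -- `j_{p,1}` is indeed the first positive zero of `J_p`
    IsLeast {x : ℝ | 0 < x ∧ besselJ p x = 0} (besselFirstZero p) ∧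
    -- the double inequality (with nonzero denominators) for `α` and `β`
    (∀ x ∈ Set.Ioo 0 (besselFirstZero p),
      frameDen p (frameAlpha p) x ≠ 0 ∧ frameDen p (frameBeta p) x ≠ 0 ∧
      frameNum p (frameAlpha p) x / frameDen p (frameAlpha p) x < 1 ∧
      1 < frameNum p (frameBeta p) x / frameDen p (frameBeta p) x) ∧
    -- `α` is the largest constant for which the left inequality holds on the interval
    (∀ c : ℝ, (∀ x ∈ Set.Ioo 0 (besselFirstZero p), frameNum p c x / frameDen p c x < 1) →
      c ≤ frameAlpha p) ∧
    -- `β` is the smallest constant for which the right inequality holds on the interval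
    (∀ c : ℝ, (∀ x ∈ Set.Ioo 0 (besselFirstZero p), 1 < frameNum p c x / frameDen p c x) →
      frameBeta p ≤ c) := by
  have ha : 0 < p + 1 := by linarith
  have ha' : p + 1 ≤ 1 / 2 := by linarith
  have ha1 : 0 < p + 1 + 1 := by linarith
  obtain ⟨t₀, ht₀, h₀⟩ := exists_altSeries_besselCoeff_eq_one ha ha'
  have hleast := isLeast_besselJ_zero hp ht₀ h₀
  have hj : besselFirstZero p = 2 * √t₀ := hleast.csInf_eq
  have hI : t₀ ∈ Set.Icc (0 : ℝ) 1 := ⟨ht₀.1.le, ht₀.2.le⟩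
  have h0I : (0 : ℝ) ∈ Set.Icc (0 : ℝ) 1 := Set.left_mem_Icc.2 zero_le_one
  have hα : frameAlpha p = frameRatio (p + 1) 0 := by
    rw [frameRatio_zero, frameAlpha, show p + 1 + 2 = p + 3 by ring]
  have hβ := frameBeta_eq_frameRatio hp hp' ht₀ h₀
  have hmono := frameRatio_strictMonoOn ha ha'
  have hsub : Set.Icc 0 t₀ ⊆ Set.Icc (0 : ℝ) 1 := Set.Icc_subset_Icc_right ht₀.2.le
  have hden : ∀ c, ContinuousOn (fun t => 1 / (p + 1) + (1 - altSeries (besselCoeff (p + 1)) t) -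
      4 * c * t) (Set.Icc 0 1) := fun c =>
    (continuousOn_const.add (continuousOn_const.sub (continuousOn_altSeries (besselCoeff_pos ha)
      (two_mul_besselCoeff_succ_le ha)))).sub (continuousOn_const.mul continuousOn_id)
  have hsqrt : ∀ t ∈ Set.Ioo 0 t₀, 2 * √t ∈ Set.Ioo 0 (besselFirstZero p) := by
    intro t ht
    have h1 := Real.sqrt_pos.2 ht.1
    have h2 := Real.sqrt_lt_sqrt ht.1.le ht.2
    rw [hj]
    exact ⟨by linarith, by linarith⟩
  refine ⟨hj ▸ hleast, fun x hx => ?_, fun c hc => ?_, fun c hc => ?_⟩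
  · have hx0 : 0 < x := hx.1
    have hxt : x ^ 2 / 4 < t₀ := by
      have h1 : x ^ 2 < (2 * √t₀) ^ 2 := pow_lt_pow_left₀ (hj ▸ hx.2) hx0.le two_ne_zero
      have h2 := sq_two_mul_sqrt_div_four ht₀.1.le
      linarith
    have hx2 : 0 < x ^ 2 / 4 := by positivity
    have hxI : x ^ 2 / 4 ∈ Set.Icc (0 : ℝ) 1 := hsub ⟨hx2.le, hxt.le⟩
    have hlα := hmono h0I hxI hx2
    have hlβ := hmono hxI hI hxt
    have hg := besselQuot_pos ha1 hxI
    have hC : 0 < 4 * (x ^ 2 / 4) ^ 2 * besselQuot (p + 1 + 1) (x ^ 2 / 4) := by positivity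
    have hDβ := frameDen_frameBeta_pos hp hp' ht₀ h₀ ⟨hx2, hxt.le⟩
    have hDα : 0 < frameDen p (frameAlpha p) x := by
      rw [frameDen_eq hp _ hxI] at hDβ ⊢
      have : frameAlpha p ≤ frameBeta p := by rw [hα, hβ]; linarith
      nlinarith [mul_le_mul_of_nonneg_right this hx2.le]
    have kα := frameNum_sub_frameDen hp hp' (frameAlpha p) hxI
    have kβ := frameNum_sub_frameDen hp hp' (frameBeta p) hxI
    refine ⟨hDα.ne', hDβ.ne', ?_, ?_⟩
    · rw [div_lt_one hDα]
      have := mul_neg_of_pos_of_neg hC (sub_neg.2 (hα ▸ hlα))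
      linarith
    · rw [one_lt_div hDβ]
      have := mul_pos hC (sub_pos.2 (hβ ▸ hlβ))
      linarith
  · by_contra! hlt
    -- At `t = 0` the denominator is `1 / (p + 1) + 1` for every `c`. Keeping it positive turns the
    -- quotient bound into a sign condition.
    obtain ⟨t, ht, hA, hB⟩ := exists_pos_pos_of_continuousOn (r := 0)
      ((continuousOn_const (c := c)).sub (continuousOn_frameRatio ha ha')) (hden c)
      (Set.left_mem_Icc.2 ht₀.1.le) ht₀.1 hsub (sub_pos.2 (hα ▸ hlt))
      (by rw [altSeries_zero, sub_zero, mul_zero, sub_zero]; positivity)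
    have hsq := sq_two_mul_sqrt_div_four ht.1.le
    have htI : t ∈ Set.Icc (0 : ℝ) 1 := hsub ⟨ht.1.le, ht.2.le⟩
    have hxI : (2 * √t) ^ 2 / 4 ∈ Set.Icc (0 : ℝ) 1 := by rwa [hsq]
    have hk := frameNum_sub_frameDen hp hp' c hxI
    have hD := frameDen_eq hp c hxI
    rw [hsq] at hk hD
    have h := hc _ (hsqrt t ht)
    rw [div_lt_one (hD ▸ hB)] at h
    have hg := besselQuot_pos ha1 htI
    have ht0 := ht.1
    have hC : 0 < 4 * t ^ 2 * besselQuot (p + 1 + 1) t := by positivity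
    have := mul_pos hC hA
    simp only [Pi.sub_apply] at this
    linarith
  · by_contra! hlt
    -- Lowering the constant below `β` only raises the denominator.
    have hend : 0 < 1 / (p + 1) + (1 - altSeries (besselCoeff (p + 1)) t₀) - 4 * c * t₀ := by
      have hsq := sq_two_mul_sqrt_div_four ht₀.1.le
      have h := frameDen_frameBeta_pos (x := 2 * √t₀) hp hp' ht₀ h₀
        (by rw [hsq]; exact ⟨ht₀.1, le_rfl⟩)
      rw [frameDen_eq hp _ (by rwa [hsq]), hsq] at h
      nlinarith [mul_lt_mul_of_pos_right hlt ht₀.1]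
    obtain ⟨t, ht, hA, hB⟩ := exists_pos_pos_of_continuousOn (r := t₀)
      ((continuousOn_frameRatio ha ha').sub (continuousOn_const (c := c))) (hden c)
      (Set.right_mem_Icc.2 ht₀.1.le) ht₀.1 hsub (sub_pos.2 (hβ ▸ hlt)) hend
    have hsq := sq_two_mul_sqrt_div_four ht.1.le
    have htI : t ∈ Set.Icc (0 : ℝ) 1 := hsub ⟨ht.1.le, ht.2.le⟩
    have hxI : (2 * √t) ^ 2 / 4 ∈ Set.Icc (0 : ℝ) 1 := by rwa [hsq]
    have hk := frameNum_sub_frameDen hp hp' c hxI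
    have hD := frameDen_eq hp c hxI
    rw [hsq] at hk hD
    have h := hc _ (hsqrt t ht)
    rw [one_lt_div (hD ▸ hB)] at h
    have hg := besselQuot_pos ha1 htI
    have ht0 := ht.1
    have hC : 0 < 4 * t ^ 2 * besselQuot (p + 1 + 1) t := by positivity
    have := mul_pos hC hA
    simp only [Pi.sub_apply] at this
    linarith
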